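/- For a nonzero vector $s\in\mathbb{R}^2$, the (discrete) X-ray of a finite set $F\subset\mathbb{Z}^2$ in direction $s$ is the function that assigns to each line of $\mathbb{R}^2$ parallel to $s$ the number of points of $F$ on that line. Directions given by nonzero vectors are called different if these vectors are pairwise linearly independent. Let $n\in\mathbb{N}$ with $n=5$ or $n>6$. Then any $n$-point set $F\subset\mathbb{Z}^2$ is uniquely determined by its X-rays in any set $S$ of at least $n$ different directions in $\mathbb{R}^2$: if $G\subset\mathbb{Z}^2$ is a finite set that has the same X-ray as $F$ in every direction $s\in S$, then $G=F$. -/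

import Mathlib

/-- The lattice point `x` of `ℤ²`, seen as a point of the real plane. -/
def latticePoint (x : ℤ × ℤ) : ℝ × ℝ := ((x.1 : ℝ), (x.2 : ℝ))

/-- The set of all lines of the real plane that are parallel to the (nonzero) vector `s`. -/
def linesParallel (s : ℝ × ℝ) : Set (AffineSubspace ℝ (ℝ × ℝ)) :=
  {L | ∃ p : ℝ × ℝ, L = AffineSubspace.mk' p (Submodule.span ℝ {s})}

open Classical in
/-- The (discrete) X-ray of a finite set `F ⊆ ℤ²` in direction `s`: the function that assigns to
each line parallel to `s` the number of points of `F` on that line. -/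
noncomputable def xray (s : ℝ × ℝ) (F : Finset (ℤ × ℤ)) : linesParallel s → ℕ :=
  fun L => (F.filter fun x => latticePoint x ∈ L.1).card

/-- `S` consists of (representatives of) different directions: nonzero vectors that are pairwise
linearly independent. -/
def AreDirections (S : Set (ℝ × ℝ)) : Prop :=
  (∀ s ∈ S, s ≠ 0) ∧ S.Pairwise fun s t => LinearIndependent ℝ ![s, t]

/-! Suppose `G ≠ F`. Their symmetric difference `V` has at most `2n` points, and any line in one of
the chosen directions that meets `V` meets both `F \ G` and `G \ F`, so it contains at least two
points of `V`. Take `n` of the directions together with their negatives: each of these `2n` vectors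
`s` has a supporting line of the convex hull of `V`, with `V` on its left, and that line contains an
edge. Different `s` give edges with different starting points, so `V` has exactly `2n` points, all
of them vertices of a convex `2n`-gon with one edge for each `s`
(`card_eq_and_exists_dir_of_isStart`, `not_between`). Seen from any edge, the vertices pair off into
lines parallel to it (`pairedUpTo`). So the diagonals spanning three and five edges are parallel to
their middle edge, which forces the alternate edge vectors `x i` to satisfy `x (i + 2) = t • x (i +
1) - x i` with constant `t` (`exists_recurrence_of_parallel`). These lattice vectors recur with
period `n`. As in the crystallographic restriction, `t` is rational and of the form `ζ + ζ⁻¹` with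
`ζ` a root of unity, whence `t` is `-1`, `0` or `1` and the recurrence has period 3, 4 or 6. This is
incompatible with `n` distinct alternate edges when `n = 5` or `n > 6`. -/

/-! ### Vectors of the plane -/

/-- The determinant of two vectors of the plane. -/
def cross (a b : ℝ × ℝ) : ℝ := a.1 * b.2 - a.2 * b.1

/-- The standard scalar product of the plane. -/
def dot (a b : ℝ × ℝ) : ℝ := a.1 * b.1 + a.2 * b.2

lemma cross_neg_left (a b : ℝ × ℝ) : cross (-a) b = -cross a b := by simp [cross]; ring
lemma cross_add_right (a b c : ℝ × ℝ) : cross a (b + c) = cross a b + cross a c := by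
  simp [cross]; ring
lemma cross_sub_right (a b c : ℝ × ℝ) : cross a (b - c) = cross a b - cross a c := by
  simp [cross]; ring
lemma cross_smul_right (r : ℝ) (a b : ℝ × ℝ) : cross a (r • b) = r * cross a b := by
  simp [cross]; ring
lemma cross_smul_left (r : ℝ) (a b : ℝ × ℝ) : cross (r • a) b = r * cross a b := by
  simp [cross]; ring
lemma cross_same (a : ℝ × ℝ) : cross a a = 0 := by simp [cross]; ring
lemma cross_swap (a b : ℝ × ℝ) : cross a b = -cross b a := by simp [cross]; ring
lemma dot_neg_left (a b : ℝ × ℝ) : dot (-a) b = -dot a b := by simp [dot]; ring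
lemma dot_add_right (a b c : ℝ × ℝ) : dot a (b + c) = dot a b + dot a c := by
  simp [dot]; ring
lemma dot_smul_right (r : ℝ) (a b : ℝ × ℝ) : dot a (r • b) = r * dot a b := by
  simp [dot]; ring

lemma dot_self_pos {a : ℝ × ℝ} (ha : a ≠ 0) : 0 < dot a a := by
  have : a.1 ≠ 0 ∨ a.2 ≠ 0 := by
    by_contra! h
    exact ha (Prod.ext h.1 h.2)
  simp only [dot]
  rcases this with h | h
  · nlinarith [mul_self_pos.2 h, mul_self_nonneg a.2]
  · nlinarith [mul_self_pos.2 h, mul_self_nonneg a.1]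

/-- A vector `w - v` on which `cross s` vanishes equals its orthogonal projection onto `s`. -/
lemma eq_add_smul_of_cross_eq {s v w : ℝ × ℝ} (hs : s ≠ 0) (h : cross s w = cross s v) :
    w = v + ((dot s w - dot s v) / dot s s) • s := by
  have hp := (dot_self_pos hs).ne'
  have key : dot s s • (w - v) = (dot s w - dot s v) • s := by
    simp only [cross] at h
    ext
    · simp only [dot, Prod.fst_sub, Prod.smul_fst, smul_eq_mul]
      linear_combination -s.2 * h
    · simp only [dot, Prod.snd_sub, Prod.smul_snd, smul_eq_mul]
      linear_combination s.1 * h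
  rw [div_eq_inv_mul, mul_smul, ← key, inv_smul_smul₀ hp]
  abel

lemma eq_of_cross_eq_of_dot_eq {s v w : ℝ × ℝ} (hs : s ≠ 0) (h : cross s w = cross s v)
    (h' : dot s w = dot s v) : w = v := by
  rw [eq_add_smul_of_cross_eq hs h, h']; simp

lemma eq_of_cross_eq_of_cross_eq {s t v w : ℝ × ℝ} (hs : s ≠ 0) (hst : cross s t ≠ 0)
    (h : cross s w = cross s v) (h' : cross t w = cross t v) : w = v := by
  have h1 := eq_add_smul_of_cross_eq hs h
  generalize (dot s w - dot s v) / dot s s = c at h1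
  rw [h1, cross_add_right, cross_smul_right] at h'
  have h2 : c * cross t s = 0 := by linarith
  rcases mul_eq_zero.1 h2 with h3 | h3
  · rw [h1, h3]; simp
  · exact absurd (by rw [cross_swap, h3, neg_zero]) hst

lemma le_cross_of_mem_convexHull {V : Finset (ℝ × ℝ)} {t P : ℝ × ℝ} {c : ℝ}
    (hP : P ∈ convexHull ℝ (V : Set (ℝ × ℝ))) (h : ∀ w ∈ V, c ≤ cross t w) : c ≤ cross t P := by
  have hconv : Convex ℝ {w : ℝ × ℝ | c ≤ cross t w} := by
    intro x hx y hy a b ha hb hab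
    simp only [Set.mem_ofPred_eq] at *
    rw [cross_add_right, cross_smul_right, cross_smul_right]
    have hc : c = a * c + b * c := by rw [← add_mul, hab, one_mul]
    linarith [mul_le_mul_of_nonneg_left hx ha, mul_le_mul_of_nonneg_left hy hb]
  exact convexHull_min (fun w hw => h w hw) hconv hP

/-! ### Edges of the convex hull -/

/-- A finite point set `V` and a finite set `D` of vectors, closed under negation and otherwise
pairwise non-parallel, such that no line in a direction of `D` meets `V` in exactly one point,
and `V` has at most as many points as `D`. -/
structure MultiCovered (D V : Finset (ℝ × ℝ)) : Prop where
  ne_zero : ∀ s ∈ D, s ≠ 0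
  neg_mem : ∀ s ∈ D, -s ∈ D
  parallel : ∀ s ∈ D, ∀ t ∈ D, cross s t = 0 → t = s ∨ t = -s
  exists_not_parallel : ∀ s ∈ D, ∃ t ∈ D, cross s t ≠ 0
  nonempty : V.Nonempty
  exists_ne : ∀ s ∈ D, ∀ v ∈ V, ∃ w ∈ V, w ≠ v ∧ cross s w = cross s v
  card_le : V.card ≤ D.card

/-- `v` is the first point of `V` on the line parallel to `s` that has all of `V` on its left. -/
def IsStart (V : Finset (ℝ × ℝ)) (s v : ℝ × ℝ) : Prop :=
  v ∈ V ∧ ∀ w ∈ V, cross s v ≤ cross s w ∧ (cross s w = cross s v → dot s v ≤ dot s w)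

/-- `v` is the last point of `V` on the line parallel to `s` that has all of `V` on its left. -/
def IsEnd (V : Finset (ℝ × ℝ)) (s v : ℝ × ℝ) : Prop :=
  v ∈ V ∧ ∀ w ∈ V, cross s v ≤ cross s w ∧ (cross s w = cross s v → dot s w ≤ dot s v)

lemma exists_isStart {V : Finset (ℝ × ℝ)} (hV : V.Nonempty) (s : ℝ × ℝ) : ∃ v, IsStart V s v := by
  obtain ⟨u, hu, hmin⟩ := V.exists_min_image (cross s) hV
  obtain ⟨v, hv, hmin'⟩ := (V.filter fun w => cross s w = cross s u).exists_min_image (dot s)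
    ⟨u, by simp [hu]⟩
  simp only [Finset.mem_filter] at hv hmin'
  exact ⟨v, hv.1, fun w hw => ⟨hv.2 ▸ hmin w hw, fun h => hmin' w ⟨hw, h.trans hv.2⟩⟩⟩

lemma exists_isEnd {V : Finset (ℝ × ℝ)} (hV : V.Nonempty) (s : ℝ × ℝ) : ∃ v, IsEnd V s v := by
  obtain ⟨u, hu, hmin⟩ := V.exists_min_image (cross s) hV
  obtain ⟨v, hv, hmax⟩ := (V.filter fun w => cross s w = cross s u).exists_max_image (dot s)
    ⟨u, by simp [hu]⟩
  simp only [Finset.mem_filter] at hv hmax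
  exact ⟨v, hv.1, fun w hw => ⟨hv.2 ▸ hmin w hw, fun h => hmax w ⟨hw, h.trans hv.2⟩⟩⟩

namespace MultiCovered

variable {D V : Finset (ℝ × ℝ)}

lemma start_unique (h : MultiCovered D V) {s v w : ℝ × ℝ} (hs : s ∈ D) (hv : IsStart V s v)
    (hw : IsStart V s w) : v = w := by
  have e : cross s v = cross s w := le_antisymm (hv.2 w hw.1).1 (hw.2 v hv.1).1
  exact eq_of_cross_eq_of_dot_eq (h.ne_zero s hs) e
    (le_antisymm ((hv.2 w hw.1).2 e.symm) ((hw.2 v hv.1).2 e))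

lemma end_unique (h : MultiCovered D V) {s v w : ℝ × ℝ} (hs : s ∈ D) (hv : IsEnd V s v)
    (hw : IsEnd V s w) : v = w := by
  have e : cross s v = cross s w := le_antisymm (hv.2 w hw.1).1 (hw.2 v hv.1).1
  exact eq_of_cross_eq_of_dot_eq (h.ne_zero s hs) e
    (le_antisymm ((hw.2 v hv.1).2 e) ((hv.2 w hw.1).2 e.symm))

lemma start_ne_end (h : MultiCovered D V) {s v w : ℝ × ℝ} (hs : s ∈ D) (hv : IsStart V s v)
    (hw : IsEnd V s w) : v ≠ w := by
  rintro rfl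
  obtain ⟨u, hu, hne, e⟩ := h.exists_ne s hs v hv.1
  exact hne (eq_of_cross_eq_of_dot_eq (h.ne_zero s hs) e
    (le_antisymm ((hw.2 u hu).2 e) ((hv.2 u hu).2 e)))

lemma cross_start_eq_end {s v w : ℝ × ℝ} (hv : IsStart V s v) (hw : IsEnd V s w) :
    cross s w = cross s v :=
  le_antisymm (hw.2 v hv.1).1 (hv.2 w hw.1).1

lemma end_eq_start_add (h : MultiCovered D V) {s v w : ℝ × ℝ} (hs : s ∈ D) (hv : IsStart V s v)
    (hw : IsEnd V s w) : ∃ c : ℝ, 0 < c ∧ w = v + c • s := by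
  have e := cross_start_eq_end hv hw
  refine ⟨_, ?_, eq_add_smul_of_cross_eq (h.ne_zero s hs) e⟩
  have hle : dot s v ≤ dot s w := (hv.2 w hw.1).2 e
  have hne : dot s v ≠ dot s w := fun e' =>
    h.start_ne_end hs hv hw (eq_of_cross_eq_of_dot_eq (h.ne_zero s hs) e.symm e')
  exact div_pos (sub_pos.2 (lt_of_le_of_ne hle hne)) (dot_self_pos (h.ne_zero s hs))

/-- The end of each of the two edges lies to the left of the other, so `cross t s` and `cross s t`
are both nonnegative, hence zero. The case `t = -s` would put the end of the edge before its start.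
-/
lemma dir_unique_of_isStart (h : MultiCovered D V) {s t v : ℝ × ℝ} (hs : s ∈ D) (ht : t ∈ D)
    (hsv : IsStart V s v) (htv : IsStart V t v) : s = t := by
  obtain ⟨w, hw⟩ := exists_isEnd h.nonempty s
  obtain ⟨w', hw'⟩ := exists_isEnd h.nonempty t
  obtain ⟨c, hc, e⟩ := h.end_eq_start_add hs hsv hw
  obtain ⟨c', hc', e'⟩ := h.end_eq_start_add ht htv hw'
  have h1 := (htv.2 w hw.1).1
  have h2 := (hsv.2 w' hw'.1).1
  rw [e, cross_add_right, cross_smul_right] at h1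
  rw [e', cross_add_right, cross_smul_right] at h2
  have h3 : 0 ≤ cross t s := nonneg_of_mul_nonneg_right (by linarith) hc
  have h4 : 0 ≤ cross s t := nonneg_of_mul_nonneg_right (by linarith) hc'
  have h5 := cross_swap s t
  rcases h.parallel s hs t ht (by linarith) with h6 | h6
  · exact h6.symm
  · exfalso
    have h7 := (htv.2 w hw.1).2
    rw [h6, e, cross_neg_left, cross_neg_left, cross_add_right, cross_smul_right, cross_same,
      dot_neg_left, dot_neg_left, dot_add_right, dot_smul_right] at h7
    have := mul_pos hc (dot_self_pos (h.ne_zero s hs))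
    linarith [h7 (by ring)]

lemma dir_unique_of_isEnd (h : MultiCovered D V) {s t v : ℝ × ℝ} (hs : s ∈ D) (ht : t ∈ D)
    (hsv : IsEnd V s v) (htv : IsEnd V t v) : s = t := by
  obtain ⟨w, hw⟩ := exists_isStart h.nonempty s
  obtain ⟨w', hw'⟩ := exists_isStart h.nonempty t
  obtain ⟨c, hc, e⟩ := h.end_eq_start_add hs hw hsv
  obtain ⟨c', hc', e'⟩ := h.end_eq_start_add ht hw' htv
  have h1 := (htv.2 w hw.1).1
  have h2 := (hsv.2 w' hw'.1).1
  rw [e, cross_add_right, cross_smul_right] at h1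
  rw [e', cross_add_right, cross_smul_right] at h2
  have h3 : 0 ≤ -cross t s := nonneg_of_mul_nonneg_right (by linarith) hc
  have h4 : 0 ≤ -cross s t := nonneg_of_mul_nonneg_right (by linarith) hc'
  have h5 := cross_swap s t
  rcases h.parallel s hs t ht (by linarith) with h6 | h6
  · exact h6.symm
  · exfalso
    have h7 := (htv.2 w hw.1).2
    rw [h6, e, cross_neg_left, cross_neg_left, cross_add_right, cross_smul_right, cross_same,
      dot_neg_left, dot_neg_left, dot_add_right, dot_smul_right] at h7
    have := mul_pos hc (dot_self_pos (h.ne_zero s hs))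
    linarith [h7 (by ring)]

/-- Sending a direction to the start of its edge is injective, and `card_le` leaves no room for
further points. -/
lemma card_eq_and_exists_dir_of_isStart (h : MultiCovered D V) :
    V.card = D.card ∧ ∀ v ∈ V, ∃ s ∈ D, IsStart V s v := by
  choose p hp using fun s => exists_isStart h.nonempty s
  have hinj : Set.InjOn p D := fun s hs t ht e =>
    h.dir_unique_of_isStart hs ht (hp s) (e ▸ hp t)
  have hsub : D.image p ⊆ V := by
    intro x hx
    obtain ⟨s, -, rfl⟩ := Finset.mem_image.1 hx
    exact (hp s).1
  have hc := Finset.card_image_of_injOn hinj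
  have heq : D.image p = V := Finset.eq_of_subset_of_card_le hsub (hc ▸ h.card_le)
  refine ⟨by rw [← hc, heq], fun v hv => ?_⟩
  rw [← heq] at hv
  obtain ⟨s, hs, rfl⟩ := Finset.mem_image.1 hv
  exact ⟨s, hs, hp s⟩

lemma exists_dir_of_isEnd (h : MultiCovered D V) : ∀ v ∈ V, ∃ s ∈ D, IsEnd V s v := by
  choose p hp using fun s => exists_isEnd h.nonempty s
  have hinj : Set.InjOn p D := fun s hs t ht e =>
    h.dir_unique_of_isEnd hs ht (hp s) (e ▸ hp t)
  have hsub : D.image p ⊆ V := by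
    intro x hx
    obtain ⟨s, -, rfl⟩ := Finset.mem_image.1 hx
    exact (hp s).1
  have hc := Finset.card_image_of_injOn hinj
  have heq : D.image p = V := Finset.eq_of_subset_of_card_le hsub (hc ▸ h.card_le)
  intro v hv
  rw [← heq] at hv
  obtain ⟨s, hs, rfl⟩ := Finset.mem_image.1 hv
  exact ⟨s, hs, hp s⟩

/-- If `V` lay on one line, a line in another direction would meet it in at most one point. -/
lemma not_collinear (h : MultiCovered D V) {s x : ℝ × ℝ} (hs : s ∈ D)
    (hline : ∀ w ∈ V, cross s w = cross s x) : False := by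
  obtain ⟨t, ht, hst⟩ := h.exists_not_parallel s hs
  obtain ⟨v, hv⟩ := h.nonempty
  obtain ⟨w, hw, hne, e⟩ := h.exists_ne t ht v hv
  exact hne (eq_of_cross_eq_of_cross_eq (h.ne_zero s hs) hst
    ((hline w hw).trans (hline v hv).symm) e)

/-- No point of `V` lies in the relative interior of a segment of the convex hull of `V` that is
parallel to a vector of `D`. -/
lemma not_between (h : MultiCovered D V) {s x P Q : ℝ × ℝ} {α γ : ℝ} (hs : s ∈ D) (hx : x ∈ V)
    (hα : 0 < α) (hγ : 0 < γ) (hP : P ∈ convexHull ℝ (V : Set (ℝ × ℝ)))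
    (hQ : Q ∈ convexHull ℝ (V : Set (ℝ × ℝ))) (hPx : P = x + (-α) • s) (hQx : Q = x + γ • s) :
    False := by
  -- A supporting line at `x` has both `P` and `Q` on its left, so it is parallel to `s`.
  have key : ∀ t ∈ D, (∀ w ∈ V, cross t x ≤ cross t w) → t = s ∨ t = -s := by
    intro t ht hle
    have h1 := le_cross_of_mem_convexHull hP hle
    have h2 := le_cross_of_mem_convexHull hQ hle
    rw [hPx, cross_add_right, cross_smul_right] at h1
    rw [hQx, cross_add_right, cross_smul_right] at h2
    have h3 : 0 ≤ -cross t s := nonneg_of_mul_nonneg_right (by linarith) hα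
    have h4 : 0 ≤ cross t s := nonneg_of_mul_nonneg_right (by linarith) hγ
    have h5 := cross_swap s t
    exact h.parallel s hs t ht (by linarith)
  -- `x` starts one edge and ends another. Their directions must be `s` and `-s`, which squeezes `V`
  -- onto a line.
  obtain ⟨t, ht, htx⟩ := h.card_eq_and_exists_dir_of_isStart.2 x hx
  obtain ⟨u, hu, hux⟩ := h.exists_dir_of_isEnd x hx
  have htu : t ≠ u := by
    rintro rfl
    exact h.start_ne_end ht htx hux rfl
  apply h.not_collinear (x := x) hs
  intro w hw
  have h1 := (htx.2 w hw).1
  have h2 := (hux.2 w hw).1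
  rcases key t ht (fun w hw => (htx.2 w hw).1) with rfl | rfl <;>
  rcases key u hu (fun w hw => (hux.2 w hw).1) with rfl | rfl
  · exact absurd rfl htu
  · rw [cross_neg_left, cross_neg_left] at h2; linarith
  · rw [cross_neg_left, cross_neg_left] at h1; linarith
  · exact absurd rfl htu

/-- The only points of `V` on an edge are its end points. -/
lemma eq_of_mem_edge (h : MultiCovered D V) {s y y' b : ℝ × ℝ} {β : ℝ} (hs : s ∈ D)
    (hy : IsStart V s y) (hy' : IsEnd V s y') (hb : b ∈ V) (hβ : 0 < β) (hβ1 : β ≤ 1)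
    (e : b = y + β • (y' - y)) : b = y' := by
  rcases hβ1.lt_or_eq with hlt | rfl
  · exfalso
    obtain ⟨c, hc, e'⟩ := h.end_eq_start_add hs hy hy'
    refine h.not_between hs hb (α := β * c) (γ := (1 - β) * c) (by positivity)
      (mul_pos (by linarith) hc) (subset_convexHull ℝ _ hy.1) (subset_convexHull ℝ _ hy'.1) ?_ ?_
    · rw [e, e']; module
    · rw [e, e']; module
  · rw [e]; module

end MultiCovered

/-! ### Levels above an edge -/

namespace MultiCovered

variable {D V : Finset (ℝ × ℝ)}

lemma eq_of_mem_edge_rev (h : MultiCovered D V) {s y y' b : ℝ × ℝ} {β : ℝ} (hs : s ∈ D)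
    (hy : IsStart V s y) (hy' : IsEnd V s y') (hb : b ∈ V) (hβ : 0 < β) (hβ1 : β ≤ 1)
    (e : b = y' + β • (y - y')) : b = y := by
  rcases hβ1.lt_or_eq with hlt | rfl
  · have := h.eq_of_mem_edge (β := 1 - β) hs hy hy' hb (by linarith) (by linarith)
      (by rw [e]; module)
    rw [this] at e
    have e2 : β • (y - y') = 0 := by simpa using e
    exact absurd (sub_eq_zero.1 ((smul_eq_zero.1 e2).resolve_left hβ.ne'))
      (h.start_ne_end hs hy hy')
  · rw [e]; module

lemma exists_point_at_height {s y y' : ℝ × ℝ} {ℓ : ℝ} (h1 : cross s y < ℓ)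
    (h1' : ℓ ≤ cross s y') :
    ∃ β : ℝ, 0 < β ∧ β ≤ 1 ∧ cross s (y + β • (y' - y)) = ℓ := by
  have hpos : 0 < cross s y' - cross s y := by linarith
  refine ⟨(ℓ - cross s y) / (cross s y' - cross s y), div_pos (by linarith) hpos,
    (div_le_one hpos).2 (by linarith), ?_⟩
  rw [cross_add_right, cross_smul_right, cross_sub_right, div_mul_cancel₀ _ hpos.ne']
  ring

/-- If two edges cross height `ℓ`, one ascending and one descending, and `V` has a point at
height `ℓ`, then the points of `V` at that height are the upper end points of both edges. -/
lemma level_eq_pair (h : MultiCovered D V) {s s₁ s₂ y y' z z' x : ℝ × ℝ} {ℓ : ℝ} (hs : s ∈ D)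
    (hs₁ : s₁ ∈ D) (hs₂ : s₂ ∈ D) (hy : IsStart V s₁ y) (hy' : IsEnd V s₁ y')
    (hz' : IsStart V s₂ z') (hz : IsEnd V s₂ z) (h1 : cross s y < ℓ) (h1' : ℓ ≤ cross s y')
    (h2 : cross s z < ℓ) (h2' : ℓ ≤ cross s z') (hx : x ∈ V) (hxl : cross s x = ℓ) :
    cross s y' = ℓ ∧ cross s z' = ℓ ∧ y' ≠ z' ∧ ∀ w ∈ V, cross s w = ℓ → w = y' ∨ w = z' := by
  obtain ⟨β, hβ, hβ1, hb⟩ := exists_point_at_height h1 h1'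
  obtain ⟨α, hα, hα1, ha⟩ := exists_point_at_height h2 h2'
  obtain ⟨c, hc, ec⟩ := h.end_eq_start_add hs₁ hy hy'
  obtain ⟨d, hd, ed⟩ := h.end_eq_start_add hs₂ hz' hz
  have hs0 := h.ne_zero s hs
  have hyb : cross s₁ (y + β • (y' - y)) = cross s₁ y := by
    rw [cross_add_right, cross_smul_right, cross_sub_right, cross_start_eq_end hy hy']; ring
  have hza : cross s₂ (z + α • (z' - z)) = cross s₂ z := by
    rw [cross_add_right, cross_smul_right, cross_sub_right, cross_start_eq_end hz' hz]; ring
  have hbH : y + β • (y' - y) ∈ convexHull ℝ (V : Set (ℝ × ℝ)) :=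
    (convex_convexHull ℝ _).add_smul_sub_mem (subset_convexHull ℝ _ hy.1)
      (subset_convexHull ℝ _ hy'.1) ⟨hβ.le, hβ1⟩
  have haH : z + α • (z' - z) ∈ convexHull ℝ (V : Set (ℝ × ℝ)) :=
    (convex_convexHull ℝ _).add_smul_sub_mem (subset_convexHull ℝ _ hz.1)
      (subset_convexHull ℝ _ hz'.1) ⟨hα.le, hα1⟩
  have hs1s : 0 < -cross s₁ s := by
    rw [ec, cross_add_right, cross_smul_right, cross_swap s s₁] at h1'
    exact pos_of_mul_pos_right (by linarith : 0 < c * (-cross s₁ s)) hc.le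
  have hs2s : 0 < cross s₂ s := by
    rw [ed, cross_add_right, cross_smul_right, cross_swap s s₂] at h2
    exact pos_of_mul_pos_right (by linarith : 0 < d * cross s₂ s) hd.le
  set b := y + β • (y' - y) with hbdef
  set a := z + α • (z' - z) with hadef
  -- Being to the left of both edges confines `w` to the segment from `a` to `b`; `not_between`
  -- excludes its interior.
  have key : ∀ w ∈ V, cross s w = ℓ → w = a ∨ w = b := by
    intro w hw hwl
    have e1 := eq_add_smul_of_cross_eq hs0 (hwl.trans hb.symm)
    have e2 := eq_add_smul_of_cross_eq hs0 (hwl.trans ha.symm)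
    set μ := (dot s w - dot s b) / dot s s
    set ν := (dot s w - dot s a) / dot s s
    have hμ : μ ≤ 0 := by
      have := (hy.2 w hw).1
      rw [e1, cross_add_right, cross_smul_right, hyb] at this
      by_contra! hcon
      nlinarith [mul_pos hcon hs1s]
    have hν : 0 ≤ ν := by
      have := (hz.2 w hw).1
      rw [e2, cross_add_right, cross_smul_right, hza] at this
      by_contra! hcon
      nlinarith [mul_pos (neg_pos.2 hcon) hs2s]
    rcases hμ.lt_or_eq with hμ | hμ
    · rcases hν.lt_or_eq with hν | hν
      · exfalso
        refine h.not_between hs hw hν (neg_pos.2 hμ) haH hbH ?_ ?_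
        · nth_rewrite 1 [e2]; module
        · nth_rewrite 1 [e1]; module
      · left; rw [e2, ← hν]; simp
    · right; rw [e1, hμ]; simp
  -- The level contains a second point, so both `a` and `b` belong to `V`; as points of `V` on
  -- edges, they are the upper end points.
  obtain ⟨x', hx', hne, e⟩ := h.exists_ne s hs x hx
  have hab : a ∈ V ∧ b ∈ V ∧ a ≠ b := by
    rcases key x hx hxl with rfl | rfl <;> rcases key x' hx' (e.trans hxl) with e' | e'
    · exact absurd e' hne
    · exact ⟨hx, e' ▸ hx', fun e'' => hne (e'.trans e''.symm)⟩
    · exact ⟨e' ▸ hx', hx, fun e'' => hne (e'.trans e'')⟩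
    · exact absurd e' hne
  obtain ⟨haV, hbV, hne'⟩ := hab
  have eb := h.eq_of_mem_edge hs₁ hy hy' hbV hβ hβ1 hbdef
  have ea := h.eq_of_mem_edge_rev hs₂ hz' hz haV hα hα1 hadef
  rw [ea] at ha key hne'
  rw [eb] at hb key hne'
  exact ⟨hb, ha, hne'.symm, fun w hw hwl => (key w hw hwl).symm⟩

end MultiCovered

/-! ### Walking around the polygon -/

/-- The vertices of a polygon in cyclic order, with the direction `dir k` of the edge from `v k`
to `v (k + 1)`. -/
structure IsBoundary (D V : Finset (ℝ × ℝ)) (v dir : ℤ → ℝ × ℝ) : Prop where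
  dir_mem : ∀ k, dir k ∈ D
  isStart : ∀ k, IsStart V (dir k) (v k)
  isEnd : ∀ k, IsEnd V (dir k) (v (k + 1))

/-- Passing from the start of an edge to its end is an injective self-map of the finite set `V`,
hence a permutation; its integer powers number the vertices. That it is a single cycle is not needed
here. -/
lemma MultiCovered.exists_isBoundary {D V : Finset (ℝ × ℝ)} (h : MultiCovered D V) :
    ∃ v dir, IsBoundary D V v dir := by
  choose p hp hps using fun v : V => h.card_eq_and_exists_dir_of_isStart.2 v v.2
  choose q hq using fun s => exists_isEnd h.nonempty s
  let f : V → V := fun v => ⟨q (p v), (hq (p v)).1⟩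
  have hf : Function.Injective f := by
    intro v w hvw
    have e : q (p v) = q (p w) := congrArg Subtype.val hvw
    have e' : p v = p w := h.dir_unique_of_isEnd (hp v) (hp w) (hq _) (e ▸ hq _)
    exact Subtype.ext (h.start_unique (hp v) (hps v) (e' ▸ hps w))
  let σ : Equiv.Perm V := Equiv.ofBijective f (Finite.injective_iff_bijective.1 hf)
  obtain ⟨v₀, hv₀⟩ := h.nonempty
  refine ⟨fun k => ((σ ^ k) ⟨v₀, hv₀⟩ : V), fun k => p ((σ ^ k) ⟨v₀, hv₀⟩),
    fun k => hp _, fun k => hps _, fun k => ?_⟩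
  have e : (σ ^ (k + 1)) ⟨v₀, hv₀⟩ = f ((σ ^ k) ⟨v₀, hv₀⟩) := by
    rw [add_comm, zpow_add, zpow_one]; rfl
  simp only [e]
  exact hq _

namespace IsBoundary

variable {D V : Finset (ℝ × ℝ)} {v dir : ℤ → ℝ × ℝ}

lemma mem (hb : IsBoundary D V v dir) (k : ℤ) : v k ∈ V := (hb.isStart k).1

lemma succ_eq (h : MultiCovered D V) (hb : IsBoundary D V v dir) {i j : ℤ} (e : v i = v j) :
    v (i + 1) = v (j + 1) := by
  have e' := h.dir_unique_of_isStart (hb.dir_mem i) (hb.dir_mem j) (hb.isStart i)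
    (e ▸ hb.isStart j)
  exact h.end_unique (hb.dir_mem i) (hb.isEnd i) (e' ▸ hb.isEnd j)

lemma pred_eq (h : MultiCovered D V) (hb : IsBoundary D V v dir) {i j : ℤ}
    (e : v (i + 1) = v (j + 1)) : v i = v j := by
  have e' := h.dir_unique_of_isEnd (hb.dir_mem i) (hb.dir_mem j) (hb.isEnd i)
    (e ▸ hb.isEnd j)
  exact h.start_unique (hb.dir_mem i) (hb.isStart i) (e' ▸ hb.isStart j)

lemma shift_eq (h : MultiCovered D V) (hb : IsBoundary D V v dir) {i j : ℤ} (e : v i = v j)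
    (k : ℤ) : v (i + k) = v (j + k) := by
  induction k using Int.induction_on with
  | zero => simpa using e
  | succ k ih => rw [← add_assoc, ← add_assoc]; exact hb.succ_eq h ih
  | pred k ih =>
    apply hb.pred_eq h
    rw [show i + (-(k : ℤ) - 1) + 1 = i + -k by ring, show j + (-(k : ℤ) - 1) + 1 = j + -k by ring]
    exact ih

lemma shift (hb : IsBoundary D V v dir) (m : ℤ) :
    IsBoundary D V (fun k => v (m + k)) (fun k => dir (m + k)) where
  dir_mem k := hb.dir_mem _
  isStart k := hb.isStart _
  isEnd k := by simpa only [add_assoc] using hb.isEnd (m + k)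

/-- An edge at constant height is the bottom edge or a top edge. -/
lemma horizontal_edge (h : MultiCovered D V) (hb : IsBoundary D V v dir) {k : ℤ}
    (e : cross (dir 0) (v (k + 1)) = cross (dir 0) (v k)) :
    v k = v 0 ∨ ∀ w ∈ V, cross (dir 0) w ≤ cross (dir 0) (v k) := by
  obtain ⟨c, hc, ec⟩ := h.end_eq_start_add (hb.dir_mem k) (hb.isStart k) (hb.isEnd k)
  have : cross (dir 0) (dir k) = 0 := by
    rw [ec, cross_add_right, cross_smul_right] at e
    exact (mul_eq_zero.1 (by linarith : c * cross (dir 0) (dir k) = 0)).resolve_left hc.ne'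
  rcases h.parallel _ (hb.dir_mem 0) _ (hb.dir_mem k) this with e' | e'
  · left
    exact h.start_unique (hb.dir_mem 0) (e' ▸ hb.isStart k) (hb.isStart 0)
  · right
    intro w hw
    have := ((hb.isStart k).2 w hw).1
    rw [e', cross_neg_left, cross_neg_left] at this
    linarith

end IsBoundary

/-! ### Pairing the vertices by height -/

/-- The points `v (-k)` and `v (k + 1)`, `k ≤ j`, are the points of `V` of height at most
`g (v (j + 1))`, and form pairs of equal height that increases with `k`. -/
structure PairedUpTo (V : Finset (ℝ × ℝ)) (g : ℝ × ℝ → ℝ) (v : ℤ → ℝ × ℝ) (j : ℕ) : Prop where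
  height_eq : ∀ k : ℕ, k ≤ j → g (v (-k)) = g (v (k + 1))
  height_lt : ∀ k l : ℕ, k < l → l ≤ j → g (v (k + 1)) < g (v (l + 1))
  ne : ∀ k : ℕ, k ≤ j → v (-k) ≠ v (k + 1)
  lower : ∀ w ∈ V, g w ≤ g (v (j + 1)) → ∃ k : ℕ, k ≤ j ∧ (w = v (-k) ∨ w = v (k + 1))

lemma PairedUpTo.height_inj {V : Finset (ℝ × ℝ)} {g : ℝ × ℝ → ℝ} {v : ℤ → ℝ × ℝ} {j : ℕ}
    (hp : PairedUpTo V g v j) {k l : ℕ} (hk : k ≤ j) (hl : l ≤ j)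
    (e : g (v (k + 1)) = g (v (l + 1))) : k = l := by
  rcases lt_trichotomy k l with h | h | h
  · exact absurd e (hp.height_lt k l h hl).ne
  · exact h
  · exact absurd e (hp.height_lt l k h hk).ne'

/-- The reflection `k ↦ 1 - k` swaps the two members of each pair, so statements about the right
side transfer to the left. -/
lemma PairedUpTo.reverse {V : Finset (ℝ × ℝ)} {g : ℝ × ℝ → ℝ} {v : ℤ → ℝ × ℝ} {j : ℕ}
    (hp : PairedUpTo V g v j) : PairedUpTo V g (fun k => v (1 - k)) j where
  height_eq k hk := by
    have := hp.height_eq k hk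
    simp only [sub_neg_eq_add, sub_add_cancel_right]
    rw [this, add_comm]
  height_lt k l hkl hl := by
    have := hp.height_lt k l hkl hl
    simp only [sub_add_cancel_right]
    rwa [hp.height_eq k (by omega), hp.height_eq l hl]
  ne k hk := by
    have := hp.ne k hk
    simp only [sub_neg_eq_add, sub_add_cancel_right]
    rw [add_comm]
    exact this.symm
  lower w hw hle := by
    simp only [sub_neg_eq_add, sub_add_cancel_right] at hle ⊢
    rw [hp.height_eq j le_rfl] at hle
    obtain ⟨k, hk, h⟩ := hp.lower w hw hle
    refine ⟨k, hk, ?_⟩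
    rw [add_comm 1 (k : ℤ)]
    exact h.symm

/-- If the next vertex were not higher, it would already be in a pair. Stepping back along the
boundary then either repeats a vertex or leaves a horizontal edge closing the polygon at the current
level, although `V` has a higher point. -/
lemma PairedUpTo.lt_next {V : Finset (ℝ × ℝ)} {g : ℝ × ℝ → ℝ} {v : ℤ → ℝ × ℝ} {j : ℕ}
    (hp : PairedUpTo V g v j) (hmem : ∀ k, v k ∈ V)
    (hpred : ∀ i k, v i = v k → v (i - 1) = v (k - 1))
    (htop : ∀ k, g (v (k + 1)) = g (v k) → v k = v 0 ∨ ∀ w ∈ V, g w ≤ g (v k))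
    (hex : ∃ w ∈ V, g (v (j + 1)) < g w) : g (v (j + 1)) < g (v (j + 2)) := by
  by_contra! hle
  have h0 : v (j + 1) ≠ v 0 := by
    intro e
    have e1 := hp.height_eq 0 (by omega)
    have e2 : j = 0 := hp.height_inj le_rfl (by omega) (by rw [e]; simpa using e1)
    subst e2
    exact hp.ne 0 le_rfl (by simpa using e.symm)
  obtain ⟨k, hk, e | e⟩ := hp.lower _ (hmem _) hle
  · rcases hk.lt_or_eq with hk | rfl
    · have e1 := hpred _ _ e
      rw [show (j : ℤ) + 2 - 1 = j + 1 by ring, show -(k : ℤ) - 1 = -((k + 1 : ℕ) : ℤ) by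
        push_cast; ring] at e1
      have e2 : j = k + 1 := hp.height_inj le_rfl hk (by rw [e1]; exact hp.height_eq _ hk)
      subst e2
      exact hp.ne _ le_rfl e1.symm
    · obtain ⟨w, hw, hlt⟩ := hex
      rcases htop (k + 1) (by
        rw [show (k : ℤ) + 1 + 1 = k + 2 by ring, e, hp.height_eq k le_rfl]) with h | h
      · exact h0 h
      · exact absurd (h w hw) (not_le.2 hlt)
  · have e1 := hpred _ _ e
    rw [show (j : ℤ) + 2 - 1 = j + 1 by ring, add_sub_cancel_right] at e1
    rcases k with _ | k
    · exact h0 (by simpa using e1)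
    · have e2 : j = k := hp.height_inj le_rfl (by omega) (by rw [e1]; push_cast; rfl)
      omega

namespace IsBoundary

variable {D V : Finset (ℝ × ℝ)} {v dir : ℤ → ℝ × ℝ}

/-- Induction on the level: the edges leaving the top pair both climb, and `level_eq_pair` shows
that the next occupied level consists exactly of their upper ends. -/
lemma pairedUpTo (h : MultiCovered D V) (hb : IsBoundary D V v dir) (j : ℕ)
    (hj : 2 * j < V.card) : PairedUpTo V (cross (dir 0)) v j := by
  have hs := hb.dir_mem 0
  induction j with
  | zero =>
    have e01 := MultiCovered.cross_start_eq_end (hb.isStart 0) (hb.isEnd 0)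
    have hne := h.start_ne_end hs (hb.isStart 0) (hb.isEnd 0)
    refine ⟨?_, by omega, ?_, ?_⟩
    · intro k hk
      obtain rfl : k = 0 := by omega
      simpa using e01.symm
    · intro k hk
      obtain rfl : k = 0 := by omega
      simpa using hne
    · intro w hw hle
      refine ⟨0, le_rfl, ?_⟩
      simp only [Nat.cast_zero, zero_add, neg_zero] at *
      have hw0 : cross (dir 0) w = cross (dir 0) (v 0) :=
        le_antisymm (hle.trans_eq e01) ((hb.isStart 0).2 w hw).1
      obtain ⟨c, hc, ec⟩ := h.end_eq_start_add hs (hb.isStart 0) (hb.isEnd 0)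
      rw [zero_add] at ec
      have ew := eq_add_smul_of_cross_eq (h.ne_zero _ hs) hw0
      have hss := dot_self_pos (h.ne_zero _ hs)
      set r := (dot (dir 0) w - dot (dir 0) (v 0)) / dot (dir 0) (dir 0) with hr
      have hr0 : 0 ≤ r := div_nonneg (sub_nonneg.2 (((hb.isStart 0).2 w hw).2 hw0)) hss.le
      have hrc : r ≤ c := by
        have := ((hb.isEnd 0).2 w hw).2 (by rw [zero_add, hw0, e01])
        rw [zero_add, ec, ew, dot_add_right, dot_add_right, dot_smul_right, dot_smul_right] at this
        exact le_of_mul_le_mul_right (by linarith) hss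
      rcases hr0.lt_or_eq with hr0 | hr0
      · right
        refine h.eq_of_mem_edge (β := r / c) hs (hb.isStart 0) (by simpa using hb.isEnd 0) hw
          (by positivity) ((div_le_one hc).2 hrc) ?_
        rw [ec, add_sub_cancel_left, smul_smul, div_mul_cancel₀ _ hc.ne']
        exact ew
      · left
        rw [ew, ← hr0]; simp
  | succ j ih =>
    have hp := ih (by omega)
    -- The pairs so far account for at most `2 * (j + 1)` points, fewer than `V.card`.
    have hex : ∃ w ∈ V, cross (dir 0) (v (j + 1)) < cross (dir 0) w := by
      by_contra! hcon
      have hsub : V ⊆ (Finset.range (j + 1)).image (fun k : ℕ => v (-k)) ∪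
          (Finset.range (j + 1)).image (fun k : ℕ => v (k + 1)) := by
        intro w hw
        obtain ⟨k, hk, e | e⟩ := hp.lower w hw (hcon w hw)
        · exact Finset.mem_union_left _
            (Finset.mem_image.2 ⟨k, Finset.mem_range.2 (by omega), e.symm⟩)
        · exact Finset.mem_union_right _
            (Finset.mem_image.2 ⟨k, Finset.mem_range.2 (by omega), e.symm⟩)
      have h1 := Finset.card_le_card hsub
      have h2 := Finset.card_union_le ((Finset.range (j + 1)).image (fun k : ℕ => v (-k)))
        ((Finset.range (j + 1)).image (fun k : ℕ => v (k + 1)))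
      have h3 := Finset.card_image_le (s := Finset.range (j + 1)) (f := fun k : ℕ => v (-k))
      have h4 := Finset.card_image_le (s := Finset.range (j + 1)) (f := fun k : ℕ => v (k + 1))
      rw [Finset.card_range] at h3 h4
      omega
    have hright : cross (dir 0) (v (j + 1)) < cross (dir 0) (v (j + 2)) := by
      refine hp.lt_next hb.mem (fun i k e => ?_) (fun k e => hb.horizontal_edge h e) hex
      exact hb.shift_eq h e (-1)
    have hleft : cross (dir 0) (v (-j)) < cross (dir 0) (v (-j - 1)) := by
      have := hp.reverse.lt_next (fun k => hb.mem _) (fun i k e => ?_) (fun k e => ?_) ?_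
      · convert this using 3 <;> ring
      · have := hb.shift_eq h e 1
        convert this using 2 <;> ring
      · rcases hb.horizontal_edge h (k := -k) (by
          convert e.symm using 3 <;> ring) with h' | h'
        · left
          have := hb.shift_eq h h' 1
          convert this using 2 <;> ring
        · right
          intro w hw
          rw [← e, show 1 - (k + 1) = -k by ring]
          exact h' w hw
      · obtain ⟨w, hw, hlt⟩ := hex
        refine ⟨w, hw, ?_⟩
        rw [show 1 - ((j : ℤ) + 1) = -j by ring, hp.height_eq j le_rfl]
        exact hlt
    obtain ⟨w₀, hw₀, hw₀'⟩ := hex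
    -- `x` is a lowest point above the current level; both climbing edges reach at least its height.
    obtain ⟨x, hx, hmin⟩ := (V.filter fun w => cross (dir 0) (v (j + 1)) < cross (dir 0) w
      ).exists_min_image (cross (dir 0)) ⟨w₀, by simp [hw₀, hw₀']⟩
    simp only [Finset.mem_filter] at hx hmin
    have e2 : v ((j : ℤ) + 1 + 1) = v (j + 2) := congrArg v (by ring)
    have e3 : v (-(j : ℤ) - 1 + 1) = v (-j) := congrArg v (by ring)
    have hlev := h.level_eq_pair hs (hb.dir_mem (j + 1)) (hb.dir_mem (-j - 1))
      (hb.isStart (j + 1)) (e2 ▸ hb.isEnd (j + 1)) (hb.isStart (-j - 1))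
      (e3 ▸ hb.isEnd (-j - 1)) hx.2 (hmin _ ⟨hb.mem _, hright⟩)
      ((hp.height_eq j le_rfl).trans_lt hx.2)
      (hmin _ ⟨hb.mem _, (hp.height_eq j le_rfl).symm.trans_lt hleft⟩) hx.1 rfl
    obtain ⟨l1, l2, l3, l4⟩ := hlev
    have c1 : -((j + 1 : ℕ) : ℤ) = -j - 1 := by push_cast; ring
    have c2 : ((j + 1 : ℕ) : ℤ) + 1 = j + 2 := by push_cast; ring
    refine ⟨fun k hk => ?_, fun k l hkl hl => ?_, fun k hk => ?_, fun w hw hle => ?_⟩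
    · rcases Nat.le_succ_iff.1 hk with hk | rfl
      · exact hp.height_eq k hk
      · rw [Nat.succ_eq_add_one, c1, c2, l1, l2]
    · rcases Nat.le_succ_iff.1 hl with hl | rfl
      · exact hp.height_lt k l hkl hl
      · rw [Nat.succ_eq_add_one, c2]
        rcases (Nat.lt_succ_iff.1 hkl).lt_or_eq with hkj | rfl
        · exact (hp.height_lt k j hkj le_rfl).trans hright
        · exact hright
    · rcases Nat.le_succ_iff.1 hk with hk | rfl
      · exact hp.ne k hk
      · rw [Nat.succ_eq_add_one, c1, c2]; exact l3.symm
    · rw [c2, l1] at hle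
      rcases le_or_gt (cross (dir 0) w) (cross (dir 0) (v (j + 1))) with hw' | hw'
      · obtain ⟨k, hk, e⟩ := hp.lower w hw hw'
        exact ⟨k, by omega, e⟩
      · refine ⟨j + 1, le_rfl, ?_⟩
        rw [c1, c2]
        exact (l4 w hw (le_antisymm hle (hmin w ⟨hw, hw'⟩))).symm

end IsBoundary

/-! ### Crystallographic restriction -/

/-- A rational number of the form `ζ + ζ⁻¹` with `ζ` a root of unity is one of
`-2, -1, 0, 1, 2`. -/
lemma rat_add_inv_of_pow_eq_one {ζ : ℂ} {n : ℕ} (hn : 0 < n) (hζ : ζ ^ n = 1) {q : ℚ}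
    (hq : (q : ℂ) = ζ + ζ⁻¹) : q = -2 ∨ q = -1 ∨ q = 0 ∨ q = 1 ∨ q = 2 := by
  have hi : IsIntegral ℤ ζ := IsIntegral.of_pow hn (hζ ▸ isIntegral_one)
  have hi' : IsIntegral ℤ ζ⁻¹ :=
    IsIntegral.of_pow hn (by rw [inv_pow, hζ, inv_one]; exact isIntegral_one)
  have hqi : IsIntegral ℤ (q : ℂ) := hq ▸ hi.add hi'
  have hqi' : IsIntegral ℤ q :=
    (isIntegral_algebraMap_iff (B := ℂ) (algebraMap ℚ ℂ).injective).1 (by simpa using hqi)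
  obtain ⟨m, hm⟩ := IsIntegrallyClosed.isIntegral_iff.1 hqi'
  have hm' : (m : ℚ) = q := by simpa using hm
  have hnorm : ‖ζ‖ = 1 := by
    have : ‖ζ‖ ^ n = 1 := by rw [← norm_pow, hζ, norm_one]
    exact (pow_eq_one_iff_of_nonneg (norm_nonneg _) hn.ne').1 this
  have hle : ‖(q : ℂ)‖ ≤ 2 := by
    rw [hq]
    calc ‖ζ + ζ⁻¹‖ ≤ ‖ζ‖ + ‖ζ⁻¹‖ := norm_add_le _ _
      _ = 2 := by rw [norm_inv, hnorm]; norm_num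
  rw [← hm'] at hle ⊢
  have hle' : |(m : ℝ)| ≤ 2 := by
    have : ‖((m : ℝ) : ℂ)‖ ≤ 2 := by simpa using hle
    rwa [Complex.norm_real, Real.norm_eq_abs] at this
  have hle'' : |m| ≤ 2 := by exact_mod_cast hle'
  obtain ⟨h1, h2⟩ := abs_le.1 hle''
  interval_cases m <;> simp

lemma exists_add_inv_eq (t : ℂ) : ∃ ζ : ℂ, ζ ≠ 0 ∧ t = ζ + ζ⁻¹ := by
  -- `ζ` and `ζ⁻¹` are the roots of `X ^ 2 - t * X + 1`, with discriminant `t ^ 2 - 4`.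
  obtain ⟨r, hr⟩ := IsAlgClosed.exists_pow_nat_eq (t ^ 2 - 4) two_pos
  have hprod : ((t + r) / 2) * ((t - r) / 2) = 1 := by linear_combination -hr / 4
  have h0 : (t + r) / 2 ≠ 0 := left_ne_zero_of_mul_eq_one hprod
  exact ⟨_, h0, by rw [inv_eq_of_mul_eq_one_right hprod]; ring⟩

/-- The crystallographic restriction, for an integer sequence with a linear recurrence of
determinant one. -/
lemma recurrence_trace_eq {f : ℕ → ℝ} {t : ℝ} {n : ℕ} (hint : ∀ i, ∃ m : ℤ, f i = m)
    (h0 : f 0 = 0) (h1 : f 1 ≠ 0) (hrec : ∀ i, f (i + 2) = t * f (i + 1) - f i) (hn : 0 < n)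
    (hn0 : f n = 0) (hn1 : f (n + 1) = f 1) : t = -1 ∨ t = 0 ∨ t = 1 := by
  obtain ⟨q, rfl⟩ : ∃ q : ℚ, t = q := by
    obtain ⟨a, ha⟩ := hint 1
    obtain ⟨b, hb⟩ := hint 2
    refine ⟨b / a, ?_⟩
    have := hrec 0
    rw [h0, sub_zero, zero_add, zero_add] at this
    push_cast
    rw [← ha, ← hb, this, mul_div_cancel_right₀ _ h1]
  obtain ⟨ζ, hζ0, hζ⟩ := exists_add_inv_eq (q : ℂ)
  -- Factoring the recurrence through the root `ζ` leaves a geometric sequence of ratio `ζ⁻¹`;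
  -- periodicity then gives `ζ ^ n = 1`.
  have hgeom : ∀ i, (f (i + 1) : ℂ) - ζ * f i = (ζ⁻¹) ^ i * f 1 := by
    intro i
    induction i with
    | zero => simp [h0]
    | succ i ih =>
      rw [hrec i, pow_succ]
      push_cast
      rw [hζ]
      have : ζ * ζ⁻¹ = 1 := mul_inv_cancel₀ hζ0
      linear_combination ζ⁻¹ * ih + (f i : ℂ) * this
  have hpow : ζ ^ n = 1 := by
    have := hgeom n
    rw [hn0, hn1] at this
    have h1' : (f 1 : ℂ) ≠ 0 := by exact_mod_cast h1
    have h2 : (ζ⁻¹) ^ n = 1 := by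
      apply mul_right_cancel₀ h1'
      rw [← this]; simp
    rwa [inv_pow, inv_eq_one] at h2
  rcases rat_add_inv_of_pow_eq_one hn hpow hζ with rfl | rfl | rfl | rfl | rfl
  -- At a double root `±1` the sequence grows linearly in absolute value and cannot return to zero.
  · exfalso
    have : ∀ i : ℕ, f i = -(-1) ^ i * i * f 1 ∧ f (i + 1) = (-1) ^ i * (i + 1) * f 1 := by
      intro i
      induction i with
      | zero => simp [h0]
      | succ i ih =>
        refine ⟨by rw [ih.2, pow_succ]; push_cast; ring, ?_⟩
        rw [hrec, ih.1, ih.2, pow_succ]; push_cast; ring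
    have h3 := (this n).1
    rw [hn0, eq_comm] at h3
    simp [h1] at h3
    omega
  · simp
  · simp
  · simp
  · exfalso
    have : ∀ i : ℕ, f i = i * f 1 ∧ f (i + 1) = (i + 1) * f 1 := by
      intro i
      induction i with
      | zero => simp [h0]
      | succ i ih =>
        refine ⟨by rw [ih.2]; push_cast; ring, ?_⟩
        rw [hrec, ih.1, ih.2]; push_cast; ring
    have h3 := (this n).1
    rw [hn0, eq_comm] at h3
    simp [h1] at h3
    omega

/-- The real points with integer coordinates. -/
def IsLattice (p : ℝ × ℝ) : Prop := ∃ x : ℤ × ℤ, p = latticePoint x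

lemma IsLattice.sub {p q : ℝ × ℝ} (hp : IsLattice p) (hq : IsLattice q) : IsLattice (p - q) := by
  obtain ⟨x, rfl⟩ := hp
  obtain ⟨y, rfl⟩ := hq
  exact ⟨x - y, by simp [latticePoint]⟩

lemma IsLattice.exists_int_cross {p q : ℝ × ℝ} (hp : IsLattice p) (hq : IsLattice q) :
    ∃ m : ℤ, cross p q = m := by
  obtain ⟨x, rfl⟩ := hp
  obtain ⟨y, rfl⟩ := hq
  exact ⟨x.1 * y.2 - x.2 * y.1, by simp [cross, latticePoint]⟩

lemma lattice_recurrence_false {x : ℕ → ℝ × ℝ} {t : ℝ} {n : ℕ} (hx : ∀ i, IsLattice (x i))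
    (hrec : ∀ i, x (i + 2) = t • x (i + 1) - x i) (h01 : cross (x 0) (x 1) ≠ 0)
    (hper : ∀ i, x (i + n) = x i) (hne : ∀ i, 0 < i → i < n → x i ≠ x 0)
    (hn : n = 5 ∨ 6 < n) : False := by
  have hn0 : 0 < n := by omega
  have ht := recurrence_trace_eq (f := fun i => cross (x 0) (x i)) (t := t) (n := n)
    (fun i => (hx 0).exists_int_cross (hx i)) (cross_same _) h01
    (fun i => by simp only [hrec, cross_sub_right, cross_smul_right]) hn0
    (by have := hper 0; rw [zero_add] at this; simp only [this, cross_same])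
    (by have := hper 1; rw [add_comm] at this; simp only [this])
  have e2 := hrec 0
  have e3 := hrec 1
  have e4 := hrec 2
  have e5 := hrec 3
  have e6 := hrec 4
  norm_num at e2 e3 e4 e5 e6
  rcases ht with rfl | rfl | rfl
  · apply hne 3 (by omega) (by omega)
    rw [e3, e2]; module
  · apply hne 4 (by omega) (by omega)
    rw [e4, e3, e2]; module
  · have h6 : x 6 = x 0 := by rw [e6, e5, e4, e3, e2]; module
    -- Period 6 exceeds `n = 5`, but both periods together would give `x 1 = x 0`.
    rcases hn with rfl | hn
    · have := hper 1
      norm_num at this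
      rw [h6] at this
      rw [← this] at h01
      exact h01 (cross_same _)
    · exact hne 6 (by omega) hn h6

/-! ### Period and diagonals of the polygon -/

namespace IsBoundary

variable {D V : Finset (ℝ × ℝ)} {v dir : ℤ → ℝ × ℝ}

/-- The `n` pairs over the edge from `v 0` to `v 1` are the `2 * n` distinct points with indices
from `-(n - 1)` to `n`. For `d > n`, both indices are shifted down by `n - 1` into this window. -/
lemma ne_zero_of_lt (h : MultiCovered D V) (hb : IsBoundary D V v dir) {n : ℕ}
    (hn : V.card = 2 * n) {d : ℤ} (hd : 0 < d) (hdn : d < 2 * n) : v d ≠ v 0 := by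
  have hp := hb.pairedUpTo h (n - 1) (by omega)
  have hinj : ∀ i j : ℤ, -(n - 1 : ℤ) ≤ i → i < j → j ≤ n → v i ≠ v j := by
    intro i j hi hij hj e
    have key : ∀ i j : ℕ, i ≤ n - 1 → j ≤ n - 1 → v (-i) ≠ v (j + 1) := by
      intro i j hi hj e
      obtain rfl : i = j := hp.height_inj hi hj (by rw [← hp.height_eq i hi, e])
      exact hp.ne i hi e
    rcases le_or_gt i 0 with hi0 | hi0
    · obtain ⟨k, rfl⟩ : ∃ k : ℕ, i = -k := ⟨i.natAbs, by omega⟩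
      rcases le_or_gt j 0 with hj0 | hj0
      · obtain ⟨l, rfl⟩ : ∃ l : ℕ, j = -l := ⟨j.natAbs, by omega⟩
        have : k = l := hp.height_inj (by omega) (by omega) (by
          rw [← hp.height_eq k (by omega), e, hp.height_eq l (by omega)])
        omega
      · obtain ⟨l, rfl⟩ : ∃ l : ℕ, j = l + 1 := ⟨(j - 1).natAbs, by omega⟩
        exact key k l (by omega) (by omega) e
    · obtain ⟨k, rfl⟩ : ∃ k : ℕ, i = k + 1 := ⟨(i - 1).natAbs, by omega⟩
      obtain ⟨l, rfl⟩ : ∃ l : ℕ, j = l + 1 := ⟨(j - 1).natAbs, by omega⟩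
      have : k = l := hp.height_inj (by omega) (by omega) (by rw [e])
      omega
  intro e
  rcases le_or_gt d n with hdn' | hdn'
  · exact hinj 0 d (by omega) hd hdn' e.symm
  · have := hb.shift_eq h e (-(n - 1 : ℤ))
    exact hinj (0 + -(n - 1 : ℤ)) (d + -(n - 1 : ℤ)) (by omega) (by omega) (by omega) this.symm

lemma periodic (h : MultiCovered D V) (hb : IsBoundary D V v dir) {n : ℕ}
    (hn : V.card = 2 * n) (k : ℤ) : v (k + 2 * n) = v k := by
  obtain ⟨i, hi, j, hj, hij, e⟩ := Finset.exists_ne_map_eq_of_card_lt_of_maps_to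
    (s := Finset.range (2 * n + 1)) (t := V) (f := fun i : ℕ => v i)
    (by simp [hn]) (fun i _ => hb.mem i)
  rw [Finset.mem_range] at hi hj
  wlog hlt : i < j generalizing i j
  · exact this j hj i hi hij.symm e.symm (by omega)
  have e1 := hb.shift_eq h e (-i)
  rw [add_neg_cancel] at e1
  have h2 : ¬ ((j : ℤ) + -i < 2 * n) := fun hlt' =>
    hb.ne_zero_of_lt h hn (by omega) hlt' e1.symm
  have h3 : (j : ℤ) + -i = 2 * n := by omega
  rw [h3] at e1
  have := hb.shift_eq h e1.symm k
  rwa [add_comm, zero_add] at this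

lemma exists_edge_smul (h : MultiCovered D V) (hb : IsBoundary D V v dir) (k : ℤ) :
    ∃ c : ℝ, 0 < c ∧ v (k + 1) - v k = c • dir k := by
  obtain ⟨c, hc, e⟩ := h.end_eq_start_add (hb.dir_mem k) (hb.isStart k) (hb.isEnd k)
  exact ⟨c, hc, by rw [e]; module⟩

lemma edge_injective (h : MultiCovered D V) (hb : IsBoundary D V v dir) {k l : ℤ}
    (e : v (k + 1) - v k = v (l + 1) - v l) : v k = v l := by
  obtain ⟨c, hc, ec⟩ := hb.exists_edge_smul h k
  obtain ⟨d, hd, ed⟩ := hb.exists_edge_smul h l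
  rw [ec, ed] at e
  have hss := dot_self_pos (h.ne_zero _ (hb.dir_mem k))
  have h1 := congrArg (cross (dir k)) e
  rw [cross_smul_right, cross_smul_right, cross_same, mul_zero, eq_comm] at h1
  have h2 := congrArg (dot (dir k)) e
  rw [dot_smul_right, dot_smul_right] at h2
  rcases h.parallel _ (hb.dir_mem k) _ (hb.dir_mem l) ((mul_eq_zero.1 h1).resolve_left hd.ne')
    with h3 | h3
  · exact h.start_unique (hb.dir_mem k) (hb.isStart k) (h3 ▸ hb.isStart l)
  · exfalso
    have h4 : dot (dir k) (-dir k) = -dot (dir k) (dir k) := by simp [dot]; ring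
    rw [h3, h4] at h2
    nlinarith [mul_pos hc hss, mul_pos hd hss]

lemma diagonals (h : MultiCovered D V) (hb : IsBoundary D V v dir) (hV : 4 < V.card) (k : ℤ) :
    cross (v (k + 1) - v k) (v (k + 2) - v (k - 1)) = 0 ∧
    cross (v (k + 1) - v k) (v (k + 3) - v (k - 2)) = 0 ∧
    0 < cross (v (k + 1) - v k) (v (k + 2) - v (k + 1)) ∧
    0 < cross (v (k + 1) - v k) (v (k + 3) - v (k + 2)) := by
  obtain ⟨c, hc, e⟩ := hb.exists_edge_smul h k
  -- With the numbering shifted, edge `k` is the bottom edge; levels 1 and 2 give the two diagonals.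
  have hp := (hb.shift k).pairedUpTo h 2 (by omega)
  have e1 := hp.height_eq 1 (by omega)
  have e2 := hp.height_eq 2 (by omega)
  have l1 := hp.height_lt 0 1 (by omega) (by omega)
  have l2 := hp.height_lt 1 2 (by omega) (by omega)
  norm_num [← sub_eq_add_neg] at e1 e2 l1 l2
  rw [e]
  simp only [cross_smul_left, cross_sub_right]
  refine ⟨?_, ?_, by nlinarith, by nlinarith⟩
  · rw [e1]; ring
  · rw [e2]; ring

end IsBoundary

/-- The edge vectors of a polygon all of whose diagonals of lengths three and five are parallel to
the middle edge satisfy a second-order recurrence in steps of two. -/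
lemma exists_recurrence_of_parallel {e : ℤ → ℝ × ℝ}
    (h3 : ∀ k, cross (e k) (e (k + 1) + e (k - 1)) = 0)
    (h5 : ∀ k, cross (e k) (e (k + 2) + e (k + 1) + e (k - 1) + e (k - 2)) = 0)
    (hpos : ∀ k, 0 < cross (e k) (e (k + 1))) :
    ∃ t : ℝ, ∀ i : ℕ, e (2 * (i + 2 : ℕ)) = t • e (2 * (i + 1 : ℕ)) - e (2 * i) := by
  have hne : ∀ k, e k ≠ 0 := fun k h0 => by
    have := hpos k
    rw [h0] at this
    simp [cross] at this
  have ha : ∀ k, ∃ a : ℝ, e (k + 1) + e (k - 1) = a • e k := fun k => by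
    have := eq_add_smul_of_cross_eq (v := 0) (hne k) ((h3 k).trans (by simp [cross]))
    exact ⟨_, this.trans (zero_add _)⟩
  choose a ha using ha
  have hdet : ∀ k, cross (e k) (e (k - 1)) = -cross (e k) (e (k + 1)) := fun k => by
    have := h3 k
    rw [cross_add_right] at this
    linarith
  -- The five-edge diagonal regroups into multiples of `e (k + 1)`, `e (k - 1)` and `e k`, and the
  -- first two have opposite determinants with `e k`.
  have hper : ∀ k, a (k + 1) = a (k - 1) := by
    intro k
    have h1 := ha (k + 1)
    have h2 := ha (k - 1)
    rw [show k + 1 + 1 = k + 2 by ring, add_sub_cancel_right] at h1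
    rw [sub_add_cancel, show k - 1 - 1 = k - 2 by ring] at h2
    have h5k := h5 k
    rw [show e (k + 2) + e (k + 1) + e (k - 1) + e (k - 2) =
      (e (k + 2) + e k) + (e k + e (k - 2)) + (e (k + 1) + e (k - 1)) + (-2 : ℝ) • e k by module,
      h1, h2, cross_add_right, cross_add_right, cross_add_right, h3, cross_smul_right,
      cross_smul_right, cross_smul_right, cross_same, hdet] at h5k
    have : (a (k + 1) - a (k - 1)) * cross (e k) (e (k + 1)) = 0 := by linarith
    exact sub_eq_zero.1 ((mul_eq_zero.1 this).resolve_right (hpos k).ne')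
  have ha0 : ∀ i : ℕ, a (2 * i) = a 0 ∧ a (2 * i + 1) = a 1 := by
    intro i
    induction i with
    | zero => simp
    | succ i ih =>
      have h1 := hper (2 * i + 1)
      have h2 := hper (2 * i + 2)
      rw [show (2 * i + 1 + 1 : ℤ) = 2 * i + 2 by ring, add_sub_cancel_right] at h1
      rw [show (2 * i + 2 - 1 : ℤ) = 2 * i + 1 by ring] at h2
      push_cast
      rw [mul_add, mul_one]
      exact ⟨h1.trans ih.1, h2.trans ih.2⟩
  -- Eliminating the odd edges from three consecutive relations gives this coefficient.
  refine ⟨a 1 * a 0 - 2, fun i => ?_⟩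
  have h1 := ha (2 * i + 1)
  have h2 := ha (2 * i + 2)
  have h3 := ha (2 * i + 3)
  rw [(ha0 i).2, show (2 * i + 1 + 1 : ℤ) = 2 * i + 2 by ring, add_sub_cancel_right] at h1
  rw [show (2 * i + 2 : ℤ) = 2 * (i + 1 : ℕ) by push_cast; ring, (ha0 (i + 1)).1,
    show (2 * (i + 1 : ℕ) + 1 : ℤ) = 2 * i + 3 by push_cast; ring,
    show (2 * (i + 1 : ℕ) - 1 : ℤ) = 2 * i + 1 by push_cast; ring] at h2
  rw [show (2 * i + 3 : ℤ) = 2 * (i + 1 : ℕ) + 1 by push_cast; ring, (ha0 (i + 1)).2,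
    show (2 * (i + 1 : ℕ) + 1 + 1 : ℤ) = 2 * (i + 2 : ℕ) by push_cast; ring,
    add_sub_cancel_right, show (2 * (i + 1 : ℕ) + 1 : ℤ) = 2 * i + 3 by push_cast; ring] at h3
  rw [show (2 * i + 2 : ℤ) = 2 * (i + 1 : ℕ) by push_cast; ring] at h1
  rw [eq_sub_of_add_eq h3, eq_sub_of_add_eq h2, sub_smul, mul_smul]
  rw [smul_sub, ← h1]
  module

lemma MultiCovered.false_of_lattice {D V : Finset (ℝ × ℝ)} (h : MultiCovered D V)
    (hV : ∀ p ∈ V, IsLattice p) {n : ℕ} (hcard : V.card = 2 * n) (hn : n = 5 ∨ 6 < n) : False := by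
  obtain ⟨v, dir, hb⟩ := h.exists_isBoundary
  have hdiag := hb.diagonals h (by omega)
  set e : ℤ → ℝ × ℝ := fun k => v (k + 1) - v k with he
  have hsum3 : ∀ k, v (k + 2) - v (k - 1) = e (k + 1) + e k + e (k - 1) := fun k => by
    simp only [he, show k + 1 + 1 = k + 2 by ring, sub_add_cancel]; abel
  have hsum5 : ∀ k, v (k + 3) - v (k - 2) = e (k + 2) + e (k + 1) + e k + e (k - 1) + e (k - 2) :=
    fun k => by
      simp only [he, show k + 1 + 1 = k + 2 by ring, show k + 2 + 1 = k + 3 by ring,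
        show k - 2 + 1 = k - 1 by ring, sub_add_cancel]
      abel
  have h3 : ∀ k, cross (e k) (e (k + 1) + e (k - 1)) = 0 := fun k => by
    have := (hdiag k).1
    rw [hsum3, cross_add_right, cross_add_right] at this
    have hs := cross_same (e k)
    rw [cross_add_right]
    linarith
  have h5 : ∀ k, cross (e k) (e (k + 2) + e (k + 1) + e (k - 1) + e (k - 2)) = 0 := fun k => by
    have := (hdiag k).2.1
    rw [hsum5] at this
    have hs := cross_same (e k)
    simp only [cross_add_right] at this ⊢
    linarith
  have hpos : ∀ k, 0 < cross (e k) (e (k + 1)) := fun k => by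
    have := (hdiag k).2.2.1
    simpa only [he, show k + 1 + 1 = k + 2 by ring] using this
  obtain ⟨t, ht⟩ := exists_recurrence_of_parallel h3 h5 hpos
  refine lattice_recurrence_false (x := fun i => e (2 * i)) (t := t) (n := n)
    (fun i => (hV _ (hb.mem _)).sub (hV _ (hb.mem _))) ht ?_ (fun i => ?_) (fun i hi hin e0 => ?_) hn
  · have := (hdiag 0).2.2.2
    exact ne_of_gt (by simpa [he] using this)
  · have h1 := hb.periodic h hcard (2 * i)
    have h2 := hb.periodic h hcard (2 * i + 1)
    simp only [he]
    push_cast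
    rw [mul_add, h1, add_right_comm, h2]
  · have := hb.edge_injective h e0
    exact hb.ne_zero_of_lt h hcard (by omega) (by omega) this

/-! ### From X-rays to the polygon -/

lemma latticePoint_injective : Function.Injective latticePoint := by
  intro x y e
  simp only [latticePoint, Prod.mk.injEq, Int.cast_inj] at e
  exact Prod.ext e.1 e.2

lemma mem_mk'_span_iff {s p q : ℝ × ℝ} (hs : s ≠ 0) :
    q ∈ AffineSubspace.mk' p (Submodule.span ℝ {s}) ↔ cross s q = cross s p := by
  rw [AffineSubspace.mem_mk', Submodule.mem_span_singleton, vsub_eq_sub]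
  constructor
  · rintro ⟨a, ha⟩
    have := congrArg (cross s) ha
    rw [cross_smul_right, cross_same, cross_sub_right] at this
    linarith
  · intro h
    exact ⟨_, (sub_eq_of_eq_add' (eq_add_smul_of_cross_eq hs h)).symm⟩

open Classical in
/-- Equal X-rays in direction `s` mean that every line parallel to `s` contains the same number
of points of both sets. -/
lemma card_filter_cross_eq {s : ℝ × ℝ} (hs : s ≠ 0) {F G : Finset (ℤ × ℤ)}
    (h : xray s G = xray s F) (p : ℝ × ℝ) :
    (G.filter fun x => cross s (latticePoint x) = cross s p).card =
      (F.filter fun x => cross s (latticePoint x) = cross s p).card := by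
  have := congrFun h ⟨AffineSubspace.mk' p (Submodule.span ℝ {s}), p, rfl⟩
  simpa only [xray, mem_mk'_span_iff hs] using this

open Classical in
lemma card_eq_of_xray_eq {s : ℝ × ℝ} (hs : s ≠ 0) {F G : Finset (ℤ × ℤ)}
    (h : xray s G = xray s F) : G.card = F.card := by
  set f : ℤ × ℤ → ℝ := fun x => cross s (latticePoint x)
  have hF : ∀ x ∈ F, f x ∈ (F ∪ G).image f := fun x hx =>
    Finset.mem_image_of_mem _ (Finset.mem_union_left _ hx)
  have hG : ∀ x ∈ G, f x ∈ (F ∪ G).image f := fun x hx =>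
    Finset.mem_image_of_mem _ (Finset.mem_union_right _ hx)
  rw [Finset.card_eq_sum_card_fiberwise hF, Finset.card_eq_sum_card_fiberwise hG]
  refine Finset.sum_congr rfl fun c hc => ?_
  obtain ⟨y, -, rfl⟩ := Finset.mem_image.1 hc
  exact card_filter_cross_eq hs h (latticePoint y)

/-- Otherwise the points of `G` on the line through `x` would all lie in `F`, and `x` would make the
count for `F` strictly larger. -/
lemma exists_mem_sdiff_of_xray_eq {s : ℝ × ℝ} (hs : s ≠ 0) {F G : Finset (ℤ × ℤ)}
    (h : xray s G = xray s F) {x : ℤ × ℤ} (hx : x ∈ F \ G) :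
    ∃ y ∈ G \ F, cross s (latticePoint y) = cross s (latticePoint x) := by
  classical
  by_contra! hcon
  have hlt : (G.filter fun y => cross s (latticePoint y) = cross s (latticePoint x)).card <
      (F.filter fun y => cross s (latticePoint y) = cross s (latticePoint x)).card := by
    refine Finset.card_lt_card ((Finset.ssubset_iff_of_subset fun y hy => ?_).2 ⟨x, ?_, ?_⟩)
    · rw [Finset.mem_filter] at hy ⊢
      refine ⟨?_, hy.2⟩
      by_contra hyF
      exact hcon y (Finset.mem_sdiff.2 ⟨hy.1, hyF⟩) hy.2
    · simp [(Finset.mem_sdiff.1 hx).1]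
    · simp [(Finset.mem_sdiff.1 hx).2]
  exact hlt.ne (card_filter_cross_eq hs h _)

lemma AreDirections.cross_ne_zero {S : Set (ℝ × ℝ)} (hS : AreDirections S) {s t : ℝ × ℝ}
    (hs : s ∈ S) (ht : t ∈ S) (hst : s ≠ t) : cross s t ≠ 0 := by
  intro h
  have hli : LinearIndependent ℝ ![s, t] := hS.2 hs ht hst
  rw [LinearIndependent.pair_iff' (hS.1 s hs)] at hli
  have := eq_add_smul_of_cross_eq (v := 0) (hS.1 s hs) (h.trans (by simp [cross]))
  exact hli _ (this.trans (zero_add _)).symm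

open Classical in
lemma AreDirections.multiCovered {T V : Finset (ℝ × ℝ)} (hT : AreDirections (T : Set (ℝ × ℝ)))
    (hT2 : 1 < T.card) (hV : V.Nonempty) (hcard : V.card ≤ 2 * T.card)
    (hcov : ∀ s ∈ T, ∀ v ∈ V, ∃ w ∈ V, w ≠ v ∧ cross s w = cross s v) :
    MultiCovered (T ∪ T.image (fun s => -s)) V ∧
      (T ∪ T.image (fun s => -s)).card = 2 * T.card := by
  have hmem : ∀ s, s ∈ T ∪ T.image (fun s => -s) ↔ s ∈ T ∨ -s ∈ T := by
    intro s
    simp [neg_eq_iff_eq_neg]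
  have hneg : ∀ s ∈ T, -s ∉ T := by
    intro s hs hs'
    have h0 := hT.1 s hs
    refine hT.cross_ne_zero hs hs' (fun e => h0 (self_eq_neg.1 e)) ?_
    simp [cross]; ring
  have hD : (T ∪ T.image (fun s => -s)).card = 2 * T.card := by
    rw [Finset.card_union_of_disjoint, Finset.card_image_of_injective _ neg_injective]
    · ring
    · rw [Finset.disjoint_left]
      intro s hs hs'
      obtain ⟨t, ht, rfl⟩ := Finset.mem_image.1 hs'
      exact hneg t ht hs
  have hne : ∀ s ∈ T, ∃ t ∈ T, cross s t ≠ 0 := fun s hs => by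
    obtain ⟨t, ht, hts⟩ := Finset.exists_mem_ne hT2 s
    exact ⟨t, ht, hT.cross_ne_zero hs ht hts.symm⟩
  have hpar : ∀ s ∈ T, ∀ t ∈ T, cross s t = 0 → t = s := fun s hs t ht h => by
    by_contra hst
    exact hT.cross_ne_zero hs ht (Ne.symm hst) h
  refine ⟨⟨?_, ?_, ?_, ?_, hV, ?_, hD ▸ hcard⟩, hD⟩
  · intro s hs
    rcases (hmem s).1 hs with h | h
    · exact hT.1 s h
    · exact neg_ne_zero.1 (hT.1 _ h)
  · intro s hs
    rw [hmem, neg_neg]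
    exact ((hmem s).1 hs).symm
  · intro s hs t ht h
    have h' : cross s (-t) = 0 := by simp only [cross, Prod.fst_neg, Prod.snd_neg] at h ⊢; linarith
    rcases (hmem s).1 hs with h1 | h1 <;> rcases (hmem t).1 ht with h2 | h2
    · exact Or.inl (hpar s h1 t h2 h)
    · exact Or.inr (neg_eq_iff_eq_neg.1 (hpar s h1 _ h2 h'))
    · exact Or.inr (hpar _ h1 t h2 (by rw [cross_neg_left, h, neg_zero]))
    · exact Or.inl (neg_injective (hpar _ h1 _ h2 (by rw [cross_neg_left, h', neg_zero])))
  · intro s hs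
    rcases (hmem s).1 hs with h | h
    · obtain ⟨t, ht, hst⟩ := hne s h
      exact ⟨t, (hmem t).2 (Or.inl ht), hst⟩
    · obtain ⟨t, ht, hst⟩ := hne _ h
      exact ⟨t, (hmem t).2 (Or.inl ht), fun e => hst (by rw [cross_neg_left, e, neg_zero])⟩
  · intro s hs v hv
    rcases (hmem s).1 hs with h | h
    · exact hcov s h v hv
    · obtain ⟨w, hw, hwv, e⟩ := hcov _ h v hv
      rw [cross_neg_left, cross_neg_left] at e
      exact ⟨w, hw, hwv, neg_injective e⟩

theorem corollary1 (n : ℕ) (hn : n = 5 ∨ 6 < n)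
    (F : Finset (ℤ × ℤ)) (hF : F.card = n)
    (S : Set (ℝ × ℝ)) (hS : AreDirections S) (hcard : (n : ℕ∞) ≤ S.encard)
    (G : Finset (ℤ × ℤ)) (hFG : ∀ s ∈ S, xray s G = xray s F) :
    G = F := by
  classical
  -- Exactly `n` directions are kept, so that `2 * n` bounds `V.card` and is also the number of
  -- signed directions.
  obtain ⟨T', hT'S, hT'n⟩ := Set.exists_subset_encard_eq hcard
  have hfin : T'.Finite := Set.finite_of_encard_eq_coe hT'n
  obtain ⟨T, rfl⟩ := hfin.exists_finset_coe
  rw [Set.encard_coe_eq_coe_finsetCard, Nat.cast_inj] at hT'n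
  have hT : AreDirections (T : Set (ℝ × ℝ)) :=
    ⟨fun s hs => hS.1 s (hT'S hs), hS.2.mono hT'S⟩
  have hx : ∀ s ∈ T, s ≠ 0 ∧ xray s G = xray s F := fun s hs =>
    ⟨hT.1 s hs, hFG s (hT'S hs)⟩
  obtain ⟨s₀, hs₀⟩ : T.Nonempty := Finset.card_pos.1 (by omega)
  have hGF : G.card = F.card := card_eq_of_xray_eq (hx s₀ hs₀).1 (hx s₀ hs₀).2
  by_contra hne
  set V : Finset (ℝ × ℝ) := ((F \ G) ∪ (G \ F)).image latticePoint with hVdef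
  have hVcard : V.card = (F \ G).card + (G \ F).card := by
    rw [hVdef, Finset.card_image_of_injective _ latticePoint_injective,
      Finset.card_union_of_disjoint disjoint_sdiff_sdiff]
  have hsd : (F \ G).card = (G \ F).card := Finset.card_sdiff_comm hGF.symm
  have hle : (F \ G).card ≤ n := hF ▸ Finset.card_le_card Finset.sdiff_subset
  have hVne : V.Nonempty := by
    refine Finset.Nonempty.image ?_ _
    rw [Finset.nonempty_iff_ne_empty]
    intro h
    rw [Finset.union_eq_empty, Finset.sdiff_eq_empty_iff_subset,
      Finset.sdiff_eq_empty_iff_subset] at h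
    exact hne (h.2.antisymm h.1)
  have hVl : ∀ p ∈ V, IsLattice p := fun p hp => by
    obtain ⟨x, -, rfl⟩ := Finset.mem_image.1 hp
    exact ⟨x, rfl⟩
  have hcov : ∀ s ∈ T, ∀ v ∈ V, ∃ w ∈ V, w ≠ v ∧ cross s w = cross s v := by
    intro s hs v hv
    obtain ⟨x, hxm, rfl⟩ := Finset.mem_image.1 hv
    rcases Finset.mem_union.1 hxm with hx' | hx'
    · obtain ⟨y, hy, e⟩ := exists_mem_sdiff_of_xray_eq (hx s hs).1 (hx s hs).2 hx'
      refine ⟨_, Finset.mem_image_of_mem _ (Finset.mem_union_right _ hy), fun h => ?_, e⟩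
      rw [latticePoint_injective h] at hy
      exact (Finset.mem_sdiff.1 hy).2 (Finset.mem_sdiff.1 hx').1
    · obtain ⟨y, hy, e⟩ := exists_mem_sdiff_of_xray_eq (hx s hs).1 (hx s hs).2.symm hx'
      refine ⟨_, Finset.mem_image_of_mem _ (Finset.mem_union_left _ hy), fun h => ?_, e⟩
      rw [latticePoint_injective h] at hy
      exact (Finset.mem_sdiff.1 hy).2 (Finset.mem_sdiff.1 hx').1
  obtain ⟨hM, hD⟩ := hT.multiCovered (by omega) hVne (by omega) hcov
  exact hM.false_of_lattice hVl
    (hM.card_eq_and_exists_dir_of_isStart.1.trans (hD.trans (by rw [hT'n]))) hn
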